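/- Let $(X,\Sigma,\nu)$ be a measure space and let $1\le p<\infty$ with $p\neq 2$; all functions are real-valued. Assume that $\nu$ is relatively nonatomic, i.e. for every $\sigma$-finite $E\in\Sigma$ the restricted measure space $(E,\Sigma|_E,\nu)$ has no atoms (an atom being a measurable set $A$ with $\nu(A)>0$ such that $\nu(B)\in\{0,\nu(A)\}$ for every measurable $B\subset A$). Assume also that $\nu$ has the separability property, i.e. every $B\in\Sigma$ with $\nu(B)<\infty$ is separable, where $B\in\Sigma$ is called separable if there is a countable family $\mathcal A$ of measurable subsets of $B$ such that for every measurable $C\subset B$ with $\nu(C)<\infty$ and every $\varepsilon>0$ there is $A\in\mathcal A$ with $\nu(A\,\triangle\,C)<\varepsilon$. Let $\kappa$ be a cardinal, let $J$ be a set with $|J|=\kappa$, and let $\ell^p(\kappa,L^p[0,1]):=\ell^p(J,L^p[0,1])$ be the space of families $(f_i)_{i\in J}$ in $L^p[0,1]$ with $\|(f_i)_{i\in J}\|^p:=\sum_{i\in J}\|f_i\|_{L^p[0,1]}^p<\infty$. If $L^p(\nu)$ is (linearly) isometrically isomorphic to $\ell^p(\kappa,L^p[0,1])$, then $(X,\Sigma,\nu)$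 admits a $\kappa$-separable envelope $\{X_i : i\in J\}$, that is, a family of $\sigma$-finite separable sets $X_i\in\Sigma$ of nonzero measure, indexed by the set $J$ of cardinality $\kappa$, such that $\nu(X_i\cap X_j)=0$ for distinct $i,j\in J$ and $$\nu(E)=\sum_{i\in J}\nu(E\cap X_i)\quad\text{for every } E\in\Sigma \text{ with } \nu(E)<\infty \text{ and } E\subset\bigcup_{i\in J}X_i .$$ Moreover, every linear isometric isomorphism $T:L^p(\nu)\to\ell^p(\kappa,L^p[0,1])$ is of the form $$T(f)=\bigl(R_i^{-1}(\theta(f)\restriction X_i)\bigr)_{i\in J}\qquad (f\in L^p(\nu))$$ for some linear isometry (not necessarily surjective) $\theta:L^p(\nu)\to L^p(\nu)$ and a family $(R_i)_{i\in J}$ of linear isometric isomorphisms $R_i:L^p[0,1]\to L^p(X_i)$. -/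

import Mathlib

open MeasureTheory
open scoped ENNReal Cardinal

namespace LpEnvelope

/-- `A` is an atom of `ν`: a measurable set of positive measure, each of whose measurable subsets
has measure `0` or `ν A`. -/
def IsMeasureAtom {X : Type*} [MeasurableSpace X] (ν : Measure X) (A : Set X) : Prop :=
  MeasurableSet A ∧ 0 < ν A ∧
    ∀ B : Set X, MeasurableSet B → B ⊆ A → ν B = 0 ∨ ν B = ν A

/-- `ν` has no atoms, in the sense of sets (not only of points). -/
def PurelyNonatomic {X : Type*} [MeasurableSpace X] (ν : Measure X) : Prop :=
  ∀ A : Set X, ¬ IsMeasureAtom ν A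

/-- The restriction of `ν` to every `σ`-finite measurable set is purely nonatomic. -/
def RelativelyNonatomic {X : Type*} [MeasurableSpace X] (ν : Measure X) : Prop :=
  ∀ E : Set X, MeasurableSet E → SigmaFinite (ν.restrict E) → PurelyNonatomic (ν.restrict E)

/-- Every measurable set of finite measure is separable. A measurable set `B` is separable if
the restriction of `ν` to `B` is a separable measure: some countable family of measurable sets
approximates every measurable set of finite measure, with respect to the measure of the
symmetric difference. -/
def HasSeparabilityProperty {X : Type*} [MeasurableSpace X] (ν : Measure X) : Prop :=
  ∀ B : Set X, MeasurableSet B → ν B < ∞ → MeasureTheory.IsSeparable (ν.restrict B)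

/-- The family `(S i)`, `i : J`, is a `κ`-separable envelope of the measure space `(X, ν)`. -/
structure IsSeparableEnvelope {X : Type*} [MeasurableSpace X] (ν : Measure X)
    {J : Type*} (κ : Cardinal) (S : J → Set X) : Prop where
  card_eq : #J = κ
  measurableSet : ∀ i, MeasurableSet (S i)
  sigmaFinite : ∀ i, SigmaFinite (ν.restrict (S i))
  separable : ∀ i, MeasureTheory.IsSeparable (ν.restrict (S i))
  measure_ne_zero : ∀ i, ν (S i) ≠ 0
  measure_inter : ∀ i j, i ≠ j → ν (S i ∩ S j) = 0
  measure_eq_tsum : ∀ E : Set X, MeasurableSet E → ν E < ∞ → E ⊆ ⋃ i, S i →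
    ν E = ∑' i, ν (E ∩ S i)

/-- The Banach space `L^p[0,1]` of real-valued functions. -/
abbrev LpUnit (p : ℝ≥0∞) : Type :=
  Lp ℝ p ((volume : Measure ℝ).restrict (Set.Icc (0 : ℝ) 1))

/-- The Banach space `ℓ^p(J, L^p[0,1])`. -/
abbrev EllpLpUnit (J : Type*) (p : ℝ≥0∞) [Fact (1 ≤ p)] : Type _ :=
  lp (fun _ : J => LpUnit p) p

end LpEnvelope

/-!
For finite `p ≠ 2`, the equality `‖f + g‖ ^ p + ‖f - g‖ ^ p = 2 * (‖f‖ ^ p + ‖g‖ ^ p)` in real `L^p` holds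
exactly when `f * g = 0` almost everywhere (`clarksonEq_Lp_iff`), and every linear isometry
preserves it. Fix an isometry `T₀` from `L^p(ν)` onto `ℓ^p(J, L^p[0,1])` and let `S i` be the support
of the function that `T₀` maps to the constant `1` in the `i`-th copy of `L^p[0,1]`. In the `ℓ^p` sum,
Clarkson's equality against that constant says that the `i`-th coordinate is `0`
(`clarksonEq_single_iff`). Hence `g` vanishes on `S i` if and only if `T₀ g` has `i`-th coordinate `0`
(`apply_eq_zero_iff`).

Everything follows from this dictionary. The sets `S i` are almost disjoint, and a function vanishing
on all of them is `0`. Since the image of an indicator has countably many nonzero coordinates, a set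
of finite measure is, up to a null set, exhausted by countably many of the `S i`, which gives the
additivity of `ν` over the family. Restricting `T₀⁻¹` to the `i`-th copy of `L^p[0,1]` and then to
`S i` is an isometric isomorphism `R i` onto `L^p(S i)` (`fiberEquiv`); no classification of separable
measure algebras is needed. Separability of `S i` follows from `σ`-finiteness and the separability
property. For any other isometry `T`, take `θ = T₀⁻¹ ∘ T`: the `i`-th coordinate of `T f` equals that of
`T₀ (θ f)`, which `R i` maps to the restriction of `θ f` to `S i`.
-/

namespace LpEnvelope

/-! ### Clarkson's equality -/

/-- Equality in Clarkson's inequality with exponent `r`. For `r ≠ 2` it says in `L^r` that the two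
functions have disjoint supports. -/
def ClarksonEq {E : Type*} [NormedAddCommGroup E] (r : ℝ) (f g : E) : Prop :=
  ‖f + g‖ ^ r + ‖f - g‖ ^ r = 2 * (‖f‖ ^ r + ‖g‖ ^ r)

theorem clarksonEq_map_iff {𝕜 E F : Type*} [NormedField 𝕜] [NormedAddCommGroup E]
    [NormedAddCommGroup F] [NormedSpace 𝕜 E] [NormedSpace 𝕜 F] (T : E ≃ₗᵢ[𝕜] F) (r : ℝ)
    (f g : E) : ClarksonEq r (T f) (T g) ↔ ClarksonEq r f g := by
  simp only [ClarksonEq, ← map_add, ← map_sub, LinearIsometryEquiv.norm_map]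

theorem rpow_add_rpow_lt_add_rpow {s x y : ℝ} (hs : 1 < s) (hx : 0 < x) (hy : 0 < y) :
    x ^ s + y ^ s < (x + y) ^ s := by
  have key : ∀ {a b : ℝ}, 0 < a → 0 < b → a ^ s < a * (a + b) ^ (s - 1) := by
    intro a b ha hb
    calc a ^ s = a * a ^ (s - 1) := by rw [Real.rpow_sub_one ha.ne']; field_simp
      _ < a * (a + b) ^ (s - 1) := by
        exact mul_lt_mul_of_pos_left
          (Real.rpow_lt_rpow ha.le (lt_add_of_pos_right a hb) (sub_pos.2 hs)) ha
  have h1 := key hx hy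
  have h2 := key hy hx
  rw [add_comm y x] at h2
  calc x ^ s + y ^ s < (x + y) * (x + y) ^ (s - 1) := by linarith
    _ = (x + y) ^ s := by rw [Real.rpow_sub_one (by positivity)]; field_simp

theorem add_rpow_lt_rpow_add_rpow {s x y : ℝ} (hs : s < 1) (hx : 0 < x) (hy : 0 < y) :
    (x + y) ^ s < x ^ s + y ^ s := by
  have key : ∀ {a b : ℝ}, 0 < a → 0 < b → a * (a + b) ^ (s - 1) < a ^ s := by
    intro a b ha hb
    calc a * (a + b) ^ (s - 1) < a * a ^ (s - 1) := by
          exact mul_lt_mul_of_pos_left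
            (Real.rpow_lt_rpow_of_neg ha (lt_add_of_pos_right a hb) (sub_neg.2 hs)) ha
      _ = a ^ s := by rw [Real.rpow_sub_one ha.ne']; field_simp
  have h1 := key hx hy
  have h2 := key hy hx
  rw [add_comm y x] at h2
  calc (x + y) ^ s = (x + y) * (x + y) ^ (s - 1) := by
        rw [Real.rpow_sub_one (by positivity)]; field_simp
    _ < x ^ s + y ^ s := by linarith

theorem abs_rpow_eq_sq_rpow (a r : ℝ) : |a| ^ r = (a ^ 2) ^ (r / 2) := by
  rw [← sq_abs, ← Real.rpow_natCast, ← Real.rpow_mul (abs_nonneg a)]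
  congr 1
  push_cast
  ring

/-- Clarkson's scalar inequality for exponents above `2`. With `s = r / 2`, it combines convexity of
`t ↦ t ^ s` at `(a + b) ^ 2`, `(a - b) ^ 2` with superadditivity at `a ^ 2`, `b ^ 2`. -/
theorem clarkson_lt {r a b : ℝ} (hr : 2 < r) (ha : a ≠ 0) (hb : b ≠ 0) :
    2 * (|a| ^ r + |b| ^ r) < |a + b| ^ r + |a - b| ^ r := by
  simp only [abs_rpow_eq_sq_rpow]
  have h1 := rpow_add_rpow_lt_add_rpow (s := r / 2) (by linarith)
    (by positivity : 0 < a ^ 2) (by positivity : 0 < b ^ 2)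
  have h2 := (convexOn_rpow (p := r / 2) (by linarith)).2 (Set.mem_Ici.2 (sq_nonneg (a + b)))
    (Set.mem_Ici.2 (sq_nonneg (a - b))) (by norm_num : (0 : ℝ) ≤ 1 / 2)
    (by norm_num : (0 : ℝ) ≤ 1 / 2) (by norm_num)
  simp only [smul_eq_mul] at h2
  rw [show 1 / 2 * (a + b) ^ 2 + 1 / 2 * (a - b) ^ 2 = a ^ 2 + b ^ 2 by ring] at h2
  linarith

/-- Clarkson's scalar inequality for exponents below `2`; the convexity argument for exponents
above `2` with all inequalities reversed. -/
theorem clarkson_gt {r a b : ℝ} (hr0 : 0 ≤ r) (hr : r < 2) (ha : a ≠ 0) (hb : b ≠ 0) :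
    |a + b| ^ r + |a - b| ^ r < 2 * (|a| ^ r + |b| ^ r) := by
  simp only [abs_rpow_eq_sq_rpow]
  have h1 := add_rpow_lt_rpow_add_rpow (s := r / 2) (by linarith)
    (by positivity : 0 < a ^ 2) (by positivity : 0 < b ^ 2)
  have h2 := (Real.concaveOn_rpow (p := r / 2) (by linarith) (by linarith)).2
    (Set.mem_Ici.2 (sq_nonneg (a + b)))
    (Set.mem_Ici.2 (sq_nonneg (a - b))) (by norm_num : (0 : ℝ) ≤ 1 / 2)
    (by norm_num : (0 : ℝ) ≤ 1 / 2) (by norm_num)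
  simp only [smul_eq_mul] at h2
  rw [show 1 / 2 * (a + b) ^ 2 + 1 / 2 * (a - b) ^ 2 = a ^ 2 + b ^ 2 by ring] at h2
  linarith

theorem clarkson_eq_of_mul_eq_zero {r a b : ℝ} (hr : r ≠ 0) (h : a * b = 0) :
    |a + b| ^ r + |a - b| ^ r = 2 * (|a| ^ r + |b| ^ r) := by
  rcases mul_eq_zero.1 h with rfl | rfl <;> simp [Real.zero_rpow hr] <;> ring

/-- For `r ≠ 2`, the defect in Clarkson's scalar inequality has a constant sign `σ` and vanishes only
on the coordinate axes. -/
theorem exists_sign_clarkson {r : ℝ} (hr0 : 0 < r) (hr : r ≠ 2) :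
    ∃ σ : ℝ, σ ≠ 0 ∧ ∀ a b : ℝ,
      0 ≤ σ * (|a + b| ^ r + |a - b| ^ r - 2 * (|a| ^ r + |b| ^ r)) ∧
      (σ * (|a + b| ^ r + |a - b| ^ r - 2 * (|a| ^ r + |b| ^ r)) = 0 ↔ a * b = 0) := by
  rcases hr.lt_or_gt with h | h
  · refine ⟨-1, by norm_num, fun a b => ?_⟩
    by_cases hab : a * b = 0
    · simp [clarkson_eq_of_mul_eq_zero hr0.ne' hab, hab]
    · have := clarkson_gt hr0.le h (left_ne_zero_of_mul hab) (right_ne_zero_of_mul hab)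
      exact ⟨by linarith, iff_of_false (by linarith) hab⟩
  · refine ⟨1, by norm_num, fun a b => ?_⟩
    by_cases hab : a * b = 0
    · simp [clarkson_eq_of_mul_eq_zero hr0.ne' hab, hab]
    · have := clarkson_lt h (left_ne_zero_of_mul hab) (right_ne_zero_of_mul hab)
      exact ⟨by linarith, iff_of_false (by linarith) hab⟩

section Lp

variable {X : Type*} [MeasurableSpace X] {μ : Measure X} {p : ℝ≥0∞}

theorem norm_rpow_eq_integral (hp0 : p ≠ 0) (hp : p ≠ ∞) (f : Lp ℝ p μ) :
    ‖f‖ ^ p.toReal = ∫ x, |f x| ^ p.toReal ∂μ := by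
  have hpos : 0 < p.toReal := ENNReal.toReal_pos hp0 hp
  have hnn : 0 ≤ ∫ x, ‖f x‖ ^ p.toReal ∂μ := integral_nonneg fun x => by positivity
  rw [Lp.norm_def, (Lp.memLp f).eLpNorm_eq_integral_rpow_norm hp0 hp,
    ENNReal.toReal_ofReal (by positivity), Real.rpow_inv_rpow hnn hpos.ne']
  rfl

theorem integrable_abs_rpow (hp0 : p ≠ 0) (hp : p ≠ ∞) (f : Lp ℝ p μ) :
    Integrable (fun x => |f x| ^ p.toReal) μ :=
  (Lp.memLp f).integrable_norm_rpow hp0 hp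

/-- For `p ≠ 2`, equality in Clarkson's inequality characterizes disjointness in `L^p`: the integral
of the pointwise defect, which has a constant sign, vanishes. -/
theorem clarksonEq_Lp_iff [Fact (1 ≤ p)] (hp : p ≠ ∞) (hp2 : p ≠ 2) (f g : Lp ℝ p μ) :
    ClarksonEq p.toReal f g ↔ ∀ᵐ x ∂μ, f x * g x = 0 := by
  have hp0 : p ≠ 0 := (zero_lt_one.trans_le Fact.out).ne'
  have hpos : 0 < p.toReal := ENNReal.toReal_pos hp0 hp
  have hne : p.toReal ≠ 2 := fun h => hp2 <| by
    rw [← ENNReal.ofReal_toReal hp, h]; norm_num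
  obtain ⟨σ, hσ, hD⟩ := exists_sign_clarkson hpos hne
  have hadd : ∫ x, |(f + g : Lp ℝ p μ) x| ^ p.toReal ∂μ = ∫ x, |f x + g x| ^ p.toReal ∂μ := by
    refine integral_congr_ae ?_
    filter_upwards [Lp.coeFn_add f g] with x hx
    rw [hx, Pi.add_apply]
  have hsub : ∫ x, |(f - g : Lp ℝ p μ) x| ^ p.toReal ∂μ = ∫ x, |f x - g x| ^ p.toReal ∂μ := by
    refine integral_congr_ae ?_
    filter_upwards [Lp.coeFn_sub f g] with x hx
    rw [hx, Pi.sub_apply]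
  have iadd : Integrable (fun x => |f x + g x| ^ p.toReal) μ :=
    (integrable_abs_rpow hp0 hp (f + g)).congr <| by
      filter_upwards [Lp.coeFn_add f g] with x hx
      rw [hx, Pi.add_apply]
  have isub : Integrable (fun x => |f x - g x| ^ p.toReal) μ :=
    (integrable_abs_rpow hp0 hp (f - g)).congr <| by
      filter_upwards [Lp.coeFn_sub f g] with x hx
      rw [hx, Pi.sub_apply]
  have iF := integrable_abs_rpow hp0 hp f
  have iG := integrable_abs_rpow hp0 hp g
  have iS : Integrable (fun x => |f x + g x| ^ p.toReal + |f x - g x| ^ p.toReal) μ := iadd.add isub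
  have iT : Integrable (fun x => 2 * (|f x| ^ p.toReal + |g x| ^ p.toReal)) μ :=
    (iF.add iG).const_mul 2
  have iD : Integrable (fun x => σ * (|f x + g x| ^ p.toReal + |f x - g x| ^ p.toReal
      - 2 * (|f x| ^ p.toReal + |g x| ^ p.toReal))) μ :=
    (iS.sub iT).const_mul σ
  have hint : ∫ x, σ * (|f x + g x| ^ p.toReal + |f x - g x| ^ p.toReal
      - 2 * (|f x| ^ p.toReal + |g x| ^ p.toReal)) ∂μ =
      σ * (‖f + g‖ ^ p.toReal + ‖f - g‖ ^ p.toReal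
        - 2 * (‖f‖ ^ p.toReal + ‖g‖ ^ p.toReal)) := by
    rw [integral_const_mul, integral_sub iS iT,
      integral_add iadd isub, integral_const_mul, integral_add iF iG]
    simp only [norm_rpow_eq_integral hp0 hp, hadd, hsub]
  have h0 := integral_eq_zero_iff_of_nonneg (fun x => (hD (f x) (g x)).1) iD
  rw [hint, mul_eq_zero, or_iff_right hσ, sub_eq_zero] at h0
  refine h0.trans (Filter.eventually_congr (Filter.Eventually.of_forall fun x => ?_))
  exact (hD (f x) (g x)).2

end Lp

section lp

variable {ι : Type*} {E : ι → Type*} [∀ i, NormedAddCommGroup (E i)] [DecidableEq ι]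
  {p : ℝ≥0∞}

theorem norm_rpow_add_norm_rpow_of_forall_ne (hp : 0 < p.toReal) {F G : lp E p} {i : ι}
    (h : ∀ j, j ≠ i → F j = G j) :
    ‖F‖ ^ p.toReal + ‖G i‖ ^ p.toReal = ‖G‖ ^ p.toReal + ‖F i‖ ^ p.toReal := by
  have hF := lp.norm_sub_norm_compl_sub_single hp F {i}
  have hG := lp.norm_sub_norm_compl_sub_single hp G {i}
  simp only [Finset.sum_singleton] at hF hG
  have : F - lp.single p i (F i) = G - lp.single p i (G i) := by
    ext j
    rcases eq_or_ne j i with rfl | hj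
    · simp
    · simp [hj, h j hj]
  rw [this] at hF
  linarith

/-- Against a family supported at one index, Clarkson's equality in an `ℓ^p` sum only concerns that
coordinate. -/
theorem clarksonEq_single_iff [Fact (1 ≤ p)] (hp : 0 < p.toReal) (F : lp E p) (i : ι) (h : E i) :
    ClarksonEq p.toReal F (lp.single p i h) ↔ ClarksonEq p.toReal (F i) h := by
  have h1 := norm_rpow_add_norm_rpow_of_forall_ne hp (F := F + lp.single p i h) (G := F) (i := i)
    (fun j hj => by simp [hj])
  have h2 := norm_rpow_add_norm_rpow_of_forall_ne hp (F := F - lp.single p i h) (G := F) (i := i)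
    (fun j hj => by simp [hj])
  have h3 := lp.norm_single (E := E) (p := p) (zero_lt_one.trans_le Fact.out) i h
  simp only [lp.coeFn_add, lp.coeFn_sub, Pi.add_apply, Pi.sub_apply, lp.single_apply_self] at h1 h2
  rw [ClarksonEq, ClarksonEq, h3]
  constructor <;> intro h <;> linarith

end lp

/-! ### Separability of σ-finite measures -/

open scoped symmDiff in
/-- A `σ`-finite measure is separable as soon as its restrictions to the members of an exhaustion
by sets of finite measure are. -/
theorem isSeparable_of_spanningSets {X : Type*} [MeasurableSpace X] (μ : Measure X) [SigmaFinite μ]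
    (h : ∀ n, MeasureTheory.IsSeparable (μ.restrict (spanningSets μ n))) :
    MeasureTheory.IsSeparable μ := by
  choose A hA hdense using fun n => (h n).exists_countable_measureDense
  refine ⟨⋃ n, (fun t => t ∩ spanningSets μ n) '' A n,
    Set.countable_iUnion fun n => (hA n).image _, ?_, ?_⟩
  · simp only [Set.mem_iUnion, Set.mem_image]
    rintro _ ⟨n, t, ht, rfl⟩
    exact ((hdense n).measurable t ht).inter (measurableSet_spanningSets μ n)
  · intro C hC hfin ε hε
    have hlim : Filter.Tendsto (fun n => μ (C \ spanningSets μ n)) Filter.atTop (nhds 0) := by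
      have := tendsto_measure_iInter_atTop (μ := μ) (s := fun n => C \ spanningSets μ n)
        (fun n => (hC.diff (measurableSet_spanningSets μ n)).nullMeasurableSet)
        (fun m n hmn => Set.sdiff_subset_sdiff_right (monotone_spanningSets μ hmn))
        ⟨0, ne_top_of_le_ne_top hfin (measure_mono Set.sdiff_subset)⟩
      rwa [← Set.sdiff_iUnion, iUnion_spanningSets, Set.sdiff_univ, measure_empty] at this
    have hε2 : 0 < ε / 2 := half_pos hε
    obtain ⟨n, hn⟩ := (hlim.eventually (gt_mem_nhds (ENNReal.ofReal_pos.2 hε2))).exists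
    obtain ⟨t, htA, ht⟩ := (hdense n).approx C hC
      (ne_top_of_le_ne_top hfin (Measure.restrict_apply_le _ _)) (ε / 2) hε2
    refine ⟨t ∩ spanningSets μ n, Set.mem_iUnion.2 ⟨n, t, htA, rfl⟩, ?_⟩
    rw [Measure.restrict_apply' (measurableSet_spanningSets μ n)] at ht
    have hsub : C ∆ (t ∩ spanningSets μ n) ⊆
        (C \ spanningSets μ n) ∪ (C ∆ t ∩ spanningSets μ n) := by
      intro x hx
      simp only [Set.mem_symmDiff, Set.mem_union, Set.mem_inter_iff, Set.mem_sdiff] at hx ⊢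
      tauto
    calc μ (C ∆ (t ∩ spanningSets μ n))
        ≤ μ (C \ spanningSets μ n) + μ (C ∆ t ∩ spanningSets μ n) :=
          (measure_mono hsub).trans (measure_union_le _ _)
      _ < ENNReal.ofReal (ε / 2) + ENNReal.ofReal (ε / 2) := ENNReal.add_lt_add hn ht
      _ = ENNReal.ofReal ε := by rw [← ENNReal.ofReal_add hε2.le hε2.le, add_halves]

theorem HasSeparabilityProperty.isSeparable_restrict {X : Type*} [MeasurableSpace X]
    {ν : Measure X} (hsep : HasSeparabilityProperty ν) {S : Set X}
    (hS : MeasurableSet S) [SigmaFinite (ν.restrict S)] : MeasureTheory.IsSeparable (ν.restrict S) := by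
  refine isSeparable_of_spanningSets _ fun n => ?_
  have hm := measurableSet_spanningSets (ν.restrict S) n
  rw [Measure.restrict_restrict hm]
  refine hsep _ (hm.inter hS) ?_
  rw [← Measure.restrict_apply hm]
  exact measure_spanningSets_lt_top _ n

/-! ### Supports of `L^p` functions -/

section Support

variable {X : Type*} [MeasurableSpace X] {ν : Measure X} {p : ℝ≥0∞}

theorem sigmaFinite_restrict_support (hp0 : p ≠ 0) (hp : p ≠ ∞) (f : Lp ℝ p ν) :
    SigmaFinite (ν.restrict (Function.support f)) := by
  obtain ⟨t, -, ht0, ht⟩ := (Lp.finStronglyMeasurable f hp0 hp).exists_set_sigmaFinite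
  refine Measure.sigmaFinite_of_le (ν.restrict t) (Measure.restrict_mono (fun x hx => ?_) le_rfl)
  by_contra hxt
  exact hx (ht0 x hxt)

theorem norm_LpToLpRestrictCLM_of_ae_eq_zero [Fact (1 ≤ p)] {S : Set X} (hS : MeasurableSet S)
    (g : Lp ℝ p ν) (h : ∀ᵐ x ∂ν, x ∉ S → g x = 0) :
    ‖LpToLpRestrictCLM X ℝ ℝ ν p S g‖ = ‖g‖ := by
  rw [Lp.norm_def, Lp.norm_def, eLpNorm_congr_ae (LpToLpRestrictCLM_coeFn ℝ S g),
    ← eLpNorm_indicator_eq_eLpNorm_restrict hS]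
  congr 1
  refine eLpNorm_congr_ae ?_
  filter_upwards [h] with x hx
  by_cases hxS : x ∈ S <;> simp [hxS, hx]

theorem LpToLpRestrictCLM_surjective [Fact (1 ≤ p)] {S : Set X} (hS : MeasurableSet S) :
    Function.Surjective (LpToLpRestrictCLM X ℝ ℝ ν p S) := by
  intro h
  have hmem : MemLp (S.indicator h) p ν := (memLp_indicator_iff_restrict hS).2 (Lp.memLp h)
  refine ⟨hmem.toLp _, Lp.ext ?_⟩
  filter_upwards [LpToLpRestrictCLM_coeFn ℝ S (hmem.toLp _), ae_restrict_of_ae hmem.coeFn_toLp,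
    ae_restrict_mem hS] with x h1 h2 h3
  rw [h1, h2, Set.indicator_of_mem h3]

theorem LpToLpRestrictCLM_eq_zero_iff [Fact (1 ≤ p)] {S : Set X} (hS : MeasurableSet S)
    (g : Lp ℝ p ν) :
    LpToLpRestrictCLM X ℝ ℝ ν p S g = 0 ↔ ∀ᵐ x ∂ν, x ∈ S → g x = 0 := by
  rw [Lp.eq_zero_iff_ae_eq_zero, ← ae_restrict_iff' hS]
  refine Filter.eventually_congr ?_
  filter_upwards [LpToLpRestrictCLM_coeFn ℝ S g] with x hx
  rw [hx, Pi.zero_apply]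

end Support

/-! ### The envelope attached to an isometry -/

section Envelope

variable {X : Type*} [MeasurableSpace X] {ν : Measure X} {p : ℝ≥0∞} [Fact (1 ≤ p)] {J : Type*}
  [DecidableEq J]

/-- The function in `L^p(ν)` corresponding under `T` to the constant function `1` in the `i`-th
copy of `L^p[0,1]`. -/
noncomputable def fiberOne (T : Lp ℝ p ν ≃ₗᵢ[ℝ] EllpLpUnit J p) (i : J) : Lp ℝ p ν :=
  T.symm (lp.single p i (Lp.const p _ (1 : ℝ) : LpUnit p))

/-- The support of `fiberOne T i`, for its chosen strongly measurable representative. -/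
noncomputable def fiberSupport (T : Lp ℝ p ν ≃ₗᵢ[ℝ] EllpLpUnit J p) (i : J) : Set X :=
  Function.support (fiberOne T i)

variable (T : Lp ℝ p ν ≃ₗᵢ[ℝ] EllpLpUnit J p)

theorem measurableSet_fiberSupport (i : J) : MeasurableSet (fiberSupport T i) :=
  (Lp.stronglyMeasurable (fiberOne T i)).measurable (measurableSet_singleton 0).compl

theorem apply_fiberOne (i j : J) :
    T (fiberOne T i) j = Pi.single (M := fun _ => LpUnit p) i (Lp.const p _ (1 : ℝ)) j := by
  simp [fiberOne]

/-- The isometry `T` matches coordinates with sets: the `i`-th coordinate of `T g` vanishes exactly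
when `g` vanishes on the `i`-th support. Both conditions express Clarkson's equality, which `T`
preserves. -/
theorem apply_eq_zero_iff (hp : p ≠ ∞) (hp2 : p ≠ 2) (g : Lp ℝ p ν) (i : J) :
    T g i = 0 ↔ ∀ᵐ x ∂ν, x ∈ fiberSupport T i → g x = 0 := by
  have hp0 : p ≠ 0 := (zero_lt_one.trans_le Fact.out).ne'
  have h1 : (∀ᵐ x ∂ν, x ∈ fiberSupport T i → g x = 0) ↔ ∀ᵐ x ∂ν, g x * fiberOne T i x = 0 := by
    refine Filter.eventually_congr (Filter.Eventually.of_forall fun x => ?_)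
    rw [fiberSupport, Function.mem_support, mul_eq_zero]
    tauto
  rw [h1, ← clarksonEq_Lp_iff hp hp2, ← clarksonEq_map_iff T, fiberOne,
    LinearIsometryEquiv.apply_symm_apply, clarksonEq_single_iff (ENNReal.toReal_pos hp0 hp),
    clarksonEq_Lp_iff hp hp2, Lp.eq_zero_iff_ae_eq_zero]
  refine Filter.eventually_congr ?_
  filter_upwards [Lp.coeFn_const (p := p) (μ := (volume : Measure ℝ).restrict (Set.Icc 0 1))
    (1 : ℝ)] with x hx
  rw [hx, Function.const_apply, mul_one, Pi.zero_apply]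

theorem eq_zero_of_forall_fiberSupport (hp : p ≠ ∞) (hp2 : p ≠ 2) (g : Lp ℝ p ν)
    (h : ∀ i, ∀ᵐ x ∂ν, x ∈ fiberSupport T i → g x = 0) : g = 0 := by
  refine T.map_eq_zero_iff.1 (lp.ext (funext fun i => ?_))
  exact (apply_eq_zero_iff T hp hp2 g i).2 (h i)

/-- Two functions agree on the `i`-th support exactly when their `T`-images have the same `i`-th
coordinate. -/
theorem restrict_eq_restrict_iff (hp : p ≠ ∞) (hp2 : p ≠ 2) (g g' : Lp ℝ p ν) (i : J) :
    LpToLpRestrictCLM X ℝ ℝ ν p (fiberSupport T i) g =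
      LpToLpRestrictCLM X ℝ ℝ ν p (fiberSupport T i) g' ↔ T g i = T g' i := by
  rw [← sub_eq_zero, ← map_sub, LpToLpRestrictCLM_eq_zero_iff (measurableSet_fiberSupport T i),
    ← apply_eq_zero_iff T hp hp2, map_sub, lp.coeFn_sub, Pi.sub_apply, sub_eq_zero]

/-- The part of `T⁻¹ (single i a)` off the `i`-th support vanishes on every support, hence is `0`. -/
theorem symm_single_ae_eq_zero (hp : p ≠ ∞) (hp2 : p ≠ 2) (i : J) (a : LpUnit p) :
    ∀ᵐ x ∂ν, x ∉ fiberSupport T i → T.symm (lp.single p i a) x = 0 := by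
  set g := T.symm (lp.single p i a) with hg
  have hmem : MemLp ((fiberSupport T i)ᶜ.indicator g) p ν :=
    (Lp.memLp g).indicator (measurableSet_fiberSupport T i).compl
  have hzero : hmem.toLp _ = 0 := by
    refine eq_zero_of_forall_fiberSupport T hp hp2 _ fun j => ?_
    rcases eq_or_ne j i with rfl | hj
    · filter_upwards [hmem.coeFn_toLp] with x hx hxj
      rw [hx, Set.indicator_of_notMem (Set.notMem_compl_iff.2 hxj)]
    · have hTj : T g j = 0 := by simp [hg, hj]
      filter_upwards [hmem.coeFn_toLp, (apply_eq_zero_iff T hp hp2 g j).1 hTj] with x hx h0 hxj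
      rw [hx]
      exact Set.indicator_apply_eq_zero.2 fun _ => h0 hxj
  filter_upwards [hmem.coeFn_toLp, (Lp.eq_zero_iff_ae_eq_zero).1 hzero] with x h1 h2 hx
  rw [h1, Set.indicator_of_mem hx] at h2
  exact h2

/-- The restriction to the `i`-th support of the `T`-preimage of the `i`-th copy of `L^p[0,1]`. -/
noncomputable def fiberMap (i : J) : LpUnit p →ₗ[ℝ] Lp ℝ p (ν.restrict (fiberSupport T i)) where
  toFun a := LpToLpRestrictCLM X ℝ ℝ ν p (fiberSupport T i) (T.symm (lp.single p i a))
  map_add' a b := by rw [lp.single_add, map_add, map_add]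
  map_smul' c a := by rw [lp.single_smul, map_smul, map_smul, RingHom.id_apply]

theorem fiberMap_apply (i : J) (a : LpUnit p) : fiberMap T i a =
    LpToLpRestrictCLM X ℝ ℝ ν p (fiberSupport T i) (T.symm (lp.single p i a)) :=
  rfl

theorem norm_fiberMap (hp : p ≠ ∞) (hp2 : p ≠ 2) (i : J) (a : LpUnit p) :
    ‖fiberMap T i a‖ = ‖a‖ := by
  rw [fiberMap_apply, norm_LpToLpRestrictCLM_of_ae_eq_zero (measurableSet_fiberSupport T i) _
    (symm_single_ae_eq_zero T hp hp2 i a), LinearIsometryEquiv.norm_map,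
    lp.norm_single (zero_lt_one.trans_le Fact.out)]

theorem fiberMap_surjective (hp : p ≠ ∞) (hp2 : p ≠ 2) (i : J) :
    Function.Surjective (fiberMap T i) := by
  intro h
  obtain ⟨g, rfl⟩ := LpToLpRestrictCLM_surjective (measurableSet_fiberSupport T i) h
  refine ⟨T g i, ?_⟩
  rw [fiberMap_apply, restrict_eq_restrict_iff T hp hp2, LinearIsometryEquiv.apply_symm_apply,
    lp.single_apply_self]

/-- `T⁻¹` identifies the `i`-th copy of `L^p[0,1]` with `L^p` of the `i`-th support. -/
noncomputable def fiberEquiv (hp : p ≠ ∞) (hp2 : p ≠ 2) (i : J) :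
    LpUnit p ≃ₗᵢ[ℝ] Lp ℝ p (ν.restrict (fiberSupport T i)) :=
  LinearIsometryEquiv.ofSurjective ⟨fiberMap T i, norm_fiberMap T hp hp2 i⟩
    (fiberMap_surjective T hp hp2 i)

theorem fiberEquiv_apply (hp : p ≠ ∞) (hp2 : p ≠ 2) (i : J) (a : LpUnit p) :
    fiberEquiv T hp hp2 i a =
      LpToLpRestrictCLM X ℝ ℝ ν p (fiberSupport T i) (T.symm (lp.single p i a)) :=
  rfl

theorem measure_fiberSupport_ne_zero (hp : p ≠ ∞) (hp2 : p ≠ 2) (i : J) :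
    ν (fiberSupport T i) ≠ 0 := by
  intro h0
  have h := (apply_eq_zero_iff T hp hp2 (fiberOne T i) i).2 <| by
    filter_upwards [measure_eq_zero_iff_ae_notMem.1 h0] with x hx hx'
    exact absurd hx' hx
  rw [apply_fiberOne, Pi.single_eq_same, Lp.eq_zero_iff_ae_eq_zero] at h
  have hfalse : ∀ᵐ x ∂(volume : Measure ℝ).restrict (Set.Icc 0 1), False := by
    filter_upwards [h, Lp.coeFn_const (p := p)
      (μ := (volume : Measure ℝ).restrict (Set.Icc 0 1)) (1 : ℝ)] with x h1 h2
    exact one_ne_zero (h2.symm.trans h1)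
  rw [ae_iff] at hfalse
  simp at hfalse

theorem measure_fiberSupport_inter (hp : p ≠ ∞) (hp2 : p ≠ 2) {i j : J} (hij : i ≠ j) :
    ν (fiberSupport T i ∩ fiberSupport T j) = 0 := by
  have h := (apply_eq_zero_iff T hp hp2 (fiberOne T i) j).1 <| by
    rw [apply_fiberOne, Pi.single_eq_of_ne' hij]
  rw [measure_eq_zero_iff_ae_notMem]
  filter_upwards [h] with x hx hxij
  exact hxij.1 (hx hxij.2)

/-- The supports exhaust every set of finite measure: its indicator has countable support in the
index set, and the part of it outside the corresponding supports vanishes on all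
supports. -/
theorem measure_eq_tsum_fiberSupport (hp : p ≠ ∞) (hp2 : p ≠ 2) {E : Set X} (hE : MeasurableSet E)
    (hfin : ν E < ∞) : ν E = ∑' i, ν (E ∩ fiberSupport T i) := by
  have hp0 : p ≠ 0 := (zero_lt_one.trans_le Fact.out).ne'
  have hpos : 0 < p.toReal := ENNReal.toReal_pos hp0 hp
  have hS := measurableSet_fiberSupport T
  set g : Lp ℝ p ν := indicatorConstLp p hE hfin.ne 1
  set I : Set J := Function.support fun i => ‖T g i‖ ^ p.toReal with hI
  have hIc : I.Countable := (lp.hasSum_norm hpos (T g)).summable.countable_support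
  have hnull : ∀ i ∉ I, ν (E ∩ fiberSupport T i) = 0 := by
    intro i hi
    have hi0 : T g i = 0 := by
      simpa [hI, Real.rpow_eq_zero (norm_nonneg _) hpos.ne'] using hi
    rw [measure_eq_zero_iff_ae_notMem]
    filter_upwards [(apply_eq_zero_iff T hp hp2 g i).1 hi0,
      indicatorConstLp_coeFn_mem (p := p) (hs := hE) (hμs := hfin.ne) (c := (1 : ℝ))]
      with x h1 h2 hx
    exact one_ne_zero ((h2 hx.1).symm.trans (h1 hx.2))
  have hU : MeasurableSet (⋃ i ∈ I, fiberSupport T i) := .biUnion hIc fun i _ => hS i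
  have hD := hE.diff hU
  have hDfin : ν (E \ ⋃ i ∈ I, fiberSupport T i) ≠ ∞ :=
    ne_top_of_le_ne_top hfin.ne (measure_mono Set.sdiff_subset)
  have hrest : ν (E \ ⋃ i ∈ I, fiberSupport T i) = 0 := by
    have h0 : indicatorConstLp p hD hDfin (1 : ℝ) = 0 := by
      refine eq_zero_of_forall_fiberSupport T hp hp2 _ fun i => ?_
      by_cases hi : i ∈ I
      · filter_upwards [indicatorConstLp_coeFn_notMem (p := p) (hs := hD) (hμs := hDfin)
          (c := (1 : ℝ))] with x h1 hx
        exact h1 fun hxD => hxD.2 (Set.mem_biUnion hi hx)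
      · filter_upwards [indicatorConstLp_coeFn_notMem (p := p) (hs := hD) (hμs := hDfin)
          (c := (1 : ℝ)), measure_eq_zero_iff_ae_notMem.1 (hnull i hi)] with x h1 h2 hx
        exact h1 fun hxD => h2 ⟨hxD.1, hx⟩
    rw [measure_eq_zero_iff_ae_notMem]
    filter_upwards [(Lp.eq_zero_iff_ae_eq_zero).1 h0, indicatorConstLp_coeFn_mem (p := p)
      (hs := hD) (hμs := hDfin) (c := (1 : ℝ))] with x h1 h2 hx
    exact one_ne_zero ((h2 hx).symm.trans h1)
  rw [← measure_inter_add_sdiff E hU, hrest, add_zero, Set.inter_iUnion₂,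
    measure_biUnion₀ hIc (fun _ _ _ _ hij => ?_) fun i _ => (hE.inter (hS i)).nullMeasurableSet]
  · refine tsum_subtype_eq_of_support_subset (f := fun j => ν (E ∩ fiberSupport T j)) fun i hi => ?_
    by_contra hiI
    exact hi (hnull i hiI)
  · exact measure_mono_null (Set.inter_subset_inter Set.inter_subset_right Set.inter_subset_right)
      (measure_fiberSupport_inter T hp hp2 hij)

theorem isSeparableEnvelope_fiberSupport (hsep : HasSeparabilityProperty ν) (hp : p ≠ ∞)
    (hp2 : p ≠ 2) {κ : Cardinal} (hκ : #J = κ) : IsSeparableEnvelope ν κ (fiberSupport T) where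
  card_eq := hκ
  measurableSet := measurableSet_fiberSupport T
  sigmaFinite i := sigmaFinite_restrict_support (zero_lt_one.trans_le Fact.out).ne' hp _
  separable i :=
    have : SigmaFinite (ν.restrict (fiberSupport T i)) :=
      sigmaFinite_restrict_support (zero_lt_one.trans_le Fact.out).ne' hp _
    hsep.isSeparable_restrict (measurableSet_fiberSupport T i)
  measure_ne_zero := measure_fiberSupport_ne_zero T hp hp2
  measure_inter _ _ hij := measure_fiberSupport_inter T hp hp2 hij
  measure_eq_tsum _ hE hfin _ := measure_eq_tsum_fiberSupport T hp hp2 hE hfin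

end Envelope

end LpEnvelope

theorem mainTheorem2 {X : Type*} [MeasurableSpace X] (ν : Measure X)
    (hna : LpEnvelope.RelativelyNonatomic ν) (hsep : LpEnvelope.HasSeparabilityProperty ν)
    (p : ℝ≥0∞) [Fact (1 ≤ p)] (hp_top : p ≠ ∞) (hp_two : p ≠ 2)
    {J : Type*} (κ : Cardinal) (hκ : #J = κ)
    (hiso : Nonempty (Lp ℝ p ν ≃ₗᵢ[ℝ] LpEnvelope.EllpLpUnit J p)) :
    ∃ S : J → Set X, LpEnvelope.IsSeparableEnvelope ν κ S ∧
      ∀ T : Lp ℝ p ν ≃ₗᵢ[ℝ] LpEnvelope.EllpLpUnit J p,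
        ∃ (θ : Lp ℝ p ν →ₗᵢ[ℝ] Lp ℝ p ν)
          (R : ∀ i : J, LpEnvelope.LpUnit p ≃ₗᵢ[ℝ] Lp ℝ p (ν.restrict (S i))),
          ∀ (f : Lp ℝ p ν) (i : J),
            T f i = (R i).symm (LpToLpRestrictCLM X ℝ ℝ ν p (S i) (θ f)) := by
  classical
  obtain ⟨T₀⟩ := hiso
  refine ⟨LpEnvelope.fiberSupport T₀,
    LpEnvelope.isSeparableEnvelope_fiberSupport T₀ hsep hp_top hp_two hκ, fun T => ?_⟩
  -- The sets and the `R i` come from the fixed isometry `T₀`; for any other `T` the discrepancy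
  -- is absorbed by `θ = T₀⁻¹ ∘ T`.
  refine ⟨(T.trans T₀.symm).toLinearIsometry, LpEnvelope.fiberEquiv T₀ hp_top hp_two,
    fun f i => ?_⟩
  rw [LinearIsometryEquiv.eq_symm_apply, LpEnvelope.fiberEquiv_apply,
    LpEnvelope.restrict_eq_restrict_iff T₀ hp_top hp_two]
  simp
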